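/- All relational structures have finite domains and finite signatures; $\mathbf A\to\mathbf B$ means that there is a homomorphism from $\mathbf A$ to $\mathbf B$. A PCSP template is a pair $(\mathbf S,\mathbf T)$ of structures of the same signature $\sigma$ with $\mathbf S\to\mathbf T$. An instance is a $\sigma$-structure $\mathbf I$. For a positive integer $k$, write $\mathbf I\le_k\mathbf S$ if there is a $k$-strategy, that is, a nonempty set $\mathcal H$ of partial homomorphisms from $\mathbf I$ to $\mathbf S$ (homomorphisms to $\mathbf S$ from induced substructures of $\mathbf I$) that is closed under restrictions and such that every $h\in\mathcal H$ with $|\mathrm{dom}(h)|<k$ and every $u\in I\setminus\mathrm{dom}(h)$ admit an extension of $h$ in $\mathcal H$ with domain $\mathrm{dom}(h)\cup\{u\}$. The template $(\mathbf S,\mathbf T)$ has width $k(n)$ if for every instance $\mathbf I$ with $n$ elements $\mathbf I\le_{k(n)}\mathbf S$ implies $\mathbf I\to\mathbf T$. It has bounded width if it has width $k(n)$ for some $k(n)=O(1)$, and sublinear width if it has width $k(n)$ for some $k(n)=o(n)$. Let $M_k$ be the set of maps $f$ from a subset of $I$ of cardinality at most $k$ to $S$. For a relation symbol $R$ of arity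 $m$, let $P_R=\{y\mid A_Ry\le b_R\}\subseteq\mathbb R^{m|S|}$ be the convex hull of the $0$-$1$ characteristic vectors $v_{\mathbf t}$ of the tuples $\mathbf t\in R^{\mathbf S}$, where $(v_{\mathbf t})_{i,a}=1$ if $\mathbf t(i)=a$ and $0$ otherwise. The linear program $\mathrm{SA}^k(\mathbf I,\mathbf S)$ has a variable $x_f$ for each $f\in M_k$ and the constraints - $x_\emptyset=1$; - $\sum_{a\in S}x_{f\cup\{u\mapsto a\}}=x_f$ for $f\in M_{k-1}$ and $u\in I\setminus\mathrm{dom}(f)$; - $A_R\,\bigl(x_{f\cup\{u_i\mapsto a\}}\bigr)_{i,a}\le x_f\,b_R$ for $f\in M_{k-1}$, every relation symbol $R$ and every $(u_1,\dots,u_m)\in R^{\mathbf I}$, where $x_{f\cup\{u\mapsto a\}}$ stands for $0$ if $u\in\mathrm{dom}(f)$ and $f(u)\ne a$; - $0\le x_f\le1$ for $f\in M_k$. The template $(\mathbf S,\mathbf T)$ has SA-width $k(n)$ if for every instance $\mathbf I$ with $n$ elements feasibility of $\mathrm{SA}^{k(n)}(\mathbf I,\mathbf S)$ implies $\mathbf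 I\to\mathbf T$. It has bounded SA-width if it has SA-width $k(n)$ for some $k(n)=O(1)$. Let $s\text{-IN-}r\text{-SAT}$ be the structure with domain $\{0,1\}$ and a single $r$-ary relation that consists of all tuples with exactly $s$ ones. Let $r\text{-NAE-SAT}$ be the structure with domain $\{0,1\}$ and a single $r$-ary relation that consists of all tuples other than $(0,\dots,0)$ and $(1,\dots,1)$. **Corollary.** Let $s$ and $r$ be integers with $0<s<r$ and $r>2$. Then $(s\text{-IN-}r\text{-SAT},\ r\text{-NAE-SAT})$ is a PCSP template that has SA-width $2$, and hence bounded SA-width, but has neither sublinear width nor bounded width. -/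

import Mathlib

open Asymptotics Filter

noncomputable section

namespace PCSP

/-- A finite relational signature: finitely many relation symbols, each with an arity. -/
structure Signature where
  Symb : Type
  [finite : Finite Symb]
  arity : Symb → ℕ

/-- A relational structure of signature `σ` with domain `A`. The domain is required to be finite
wherever structures are quantified over or used as templates. -/
structure RelStr (σ : Signature) (A : Type) where
  rel : (R : σ.Symb) → Set (Fin (σ.arity R) → A)

variable {σ : Signature} {A B C : Type}

/-- `f` is a homomorphism from `M` to `N`. -/
def IsHom (M : RelStr σ A) (N : RelStr σ B) (f : A → B) : Prop :=
  ∀ R : σ.Symb, ∀ t ∈ M.rel R, (fun i => f (t i)) ∈ N.rel R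

/-- There is a homomorphism from `M` to `N`. -/
def HomTo (M : RelStr σ A) (N : RelStr σ B) : Prop :=
  ∃ f : A → B, IsHom M N f

/-- A pair of structures with finite domains is a PCSP template if the first one maps
homomorphically to the second one. -/
def IsTemplate [Fintype A] [Fintype B] (S : RelStr σ A) (T : RelStr σ B) : Prop :=
  HomTo S T

/-! ### Partial maps

A map from a subset of `A` to `B` is a function `A → Option B`; the value `none` marks the points
outside its domain. -/

/-- The domain of a partial map. -/
def dom [Fintype A] (f : A → Option B) : Finset A :=
  Finset.univ.filter fun x => (f x).isSome = true

/-- `g ⊆ f`: the partial map `f` extends `g`; equivalently, `g` is the restriction of `f` to the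
domain of `g`. -/
def SubMap (g f : A → Option B) : Prop :=
  ∀ x b, g x = some b → f x = some b

open Classical in
/-- The partial map `f ∪ {u ↦ a}`. It is used only when `u` is not in the domain of `f`
or `f u = a`. -/
def extend (f : A → Option B) (u : A) (a : B) : A → Option B :=
  Function.update f u (some a)

/-- The partial map `f` is a homomorphism to `N` from the substructure of `M` induced by the domain
of `f`: every tuple `t` of a relation of `M` all of whose entries lie in the domain of `f` has its
image `a` in the corresponding relation of `N`. -/
def IsPartialHom (M : RelStr σ A) (N : RelStr σ B) (f : A → Option B) : Prop :=
  ∀ R : σ.Symb, ∀ t ∈ M.rel R, ∀ a : Fin (σ.arity R) → B,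
    (∀ i, f (t i) = some (a i)) → a ∈ N.rel R

/-! ### The consistency algorithm -/

/-- `H` is a `k`-strategy on `J` and `S`. -/
structure IsStrategy [Fintype A] (k : ℕ) (J : RelStr σ A) (S : RelStr σ B)
    (H : Set (A → Option B)) : Prop where
  nonempty : H.Nonempty
  partialHom : ∀ h ∈ H, IsPartialHom J S h
  restrict : ∀ h ∈ H, ∀ g, SubMap g h → g ∈ H
  extension : ∀ h ∈ H, (dom h).card < k → ∀ x, x ∉ dom h → ∃ a : B, extend h x a ∈ H

/-- The relation `J ≤ₖ S`: there is a `k`-strategy on `J` and `S`. -/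
def ConsistencyLE [Fintype A] (k : ℕ) (J : RelStr σ A) (S : RelStr σ B) : Prop :=
  ∃ H : Set (A → Option B), IsStrategy k J S H

/-- `(S, T)` has (consistency) width `k(n)`: for every instance `J` with `n` elements, `J ≤ₖ₍ₙ₎ S`
implies `J → T`. -/
def HasWidth (S : RelStr σ A) (T : RelStr σ B) (k : ℕ → ℕ) : Prop :=
  ∀ (I : Type) [Fintype I] (J : RelStr σ I),
    ConsistencyLE (k (Fintype.card I)) J S → HomTo J T

/-- Width `k(n)` for some `k(n) = O(1)`. -/
def HasBoundedWidth (S : RelStr σ A) (T : RelStr σ B) : Prop :=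
  ∃ k : ℕ → ℕ, ((fun n => (k n : ℝ)) =O[atTop] fun _ => (1 : ℝ)) ∧ HasWidth S T k

/-- Width `k(n)` for some `k(n) = o(n)`. -/
def HasSublinearWidth (S : RelStr σ A) (T : RelStr σ B) : Prop :=
  ∃ k : ℕ → ℕ, ((fun n => (k n : ℝ)) =o[atTop] fun n => (n : ℝ)) ∧ HasWidth S T k

/-! ### The Sherali-Adams hierarchy -/

open Classical in
/-- The characteristic vector of a tuple `t`. -/
def charVec {m : ℕ} (t : Fin m → B) : Fin m → B → ℝ :=
  fun i b => if t i = b then 1 else 0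

/-- The polytope `P_R`: the convex hull of the characteristic vectors of the tuples in `R`. -/
def polytope {m : ℕ} (R : Set (Fin m → B)) : Set (Fin m → B → ℝ) :=
  convexHull ℝ (charVec '' R)

open Classical in
/-- The number denoted `x_{f ∪ {u ↦ a}}` in the linear program. If `f` maps `u` to an element other
than `a`, then `f ∪ {u ↦ a}` is not a map, and the number is `0`. -/
def extVal (x : (A → Option B) → ℝ) (f : A → Option B) (u : A) (a : B) : ℝ :=
  if f u = none ∨ f u = some a then x (extend f u a) else 0

/-- `x` is a feasible solution of the linear program `SA^k(J, S)`. The variables of the program are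
the values `x f` for the partial maps `f` with a domain of cardinality at most `k`; other values of
`x` are not constrained.

In `T3`, let `P_R` be described by `A y ≤ b`. The inequality `A x_{f,u} ≤ x_f b` says for `x_f > 0`
that `x_{f,u} / x_f` is in `P_R`, and for `x_f = 0` it is implied by the other constraints, which
then force `x_{f,u} = 0`. -/
structure SAFeasible [Fintype A] [Fintype B] (k : ℕ) (J : RelStr σ A) (S : RelStr σ B)
    (x : (A → Option B) → ℝ) : Prop where
  T1 : x (fun _ => none) = 1
  T2 : ∀ f : A → Option B, (dom f).card < k → ∀ u, u ∉ dom f → ∑ a : B, x (extend f u a) = x f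
  T3 : ∀ f : A → Option B, (dom f).card < k → ∀ R : σ.Symb, ∀ u ∈ J.rel R, 0 < x f →
    (x f)⁻¹ • (fun i a => extVal x f (u i) a) ∈ polytope (S.rel R)
  T4 : ∀ f : A → Option B, (dom f).card ≤ k → 0 ≤ x f ∧ x f ≤ 1

/-- The linear program `SA^k(J, S)` is feasible. -/
def SALE [Fintype A] [Fintype B] (k : ℕ) (J : RelStr σ A) (S : RelStr σ B) : Prop :=
  ∃ x : (A → Option B) → ℝ, SAFeasible k J S x

/-- `(S, T)` has SA-width `k(n)`: for every instance `J` with `n` elements, feasibility of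
`SA^{k(n)}(J, S)` implies `J → T`. -/
def HasSAWidth [Fintype A] (S : RelStr σ A) (T : RelStr σ B) (k : ℕ → ℕ) : Prop :=
  ∀ (I : Type) [Fintype I] (J : RelStr σ I),
    SALE (k (Fintype.card I)) J S → HomTo J T

/-- SA-width `k(n)` for some `k(n) = O(1)`. -/
def HasBoundedSAWidth [Fintype A] (S : RelStr σ A) (T : RelStr σ B) : Prop :=
  ∃ k : ℕ → ℕ, ((fun n => (k n : ℝ)) =O[atTop] fun _ => (1 : ℝ)) ∧ HasSAWidth S T k

/-! ### The Boolean templates -/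

/-- The signature with a single relation symbol, of arity `r`. -/
abbrev singleSig (r : ℕ) : Signature where
  Symb := Unit
  arity := fun _ => r

/-- `s`-IN-`r`-SAT: the `r`-tuples over `{0, 1}` with exactly `s` ones. -/
def exactlySAT (s r : ℕ) : RelStr (singleSig r) (Fin 2) where
  rel := fun _ => {t : Fin r → Fin 2 | (Finset.univ.filter fun i => t i = 1).card = s}

/-- `r`-NAE-SAT: the `r`-tuples over `{0, 1}` other than `(0, …, 0)` and `(1, …, 1)`. -/
def naeSAT (r : ℕ) : RelStr (singleSig r) (Fin 2) where
  rel := fun _ => {t : Fin r → Fin 2 | t ≠ (fun _ => 0) ∧ t ≠ (fun _ => 1)}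

end PCSP

end

/-! Upper bound. Read a solution of the level-2 program as local distributions, and let `q v c` be
the conditional probability of `v = 1` given `c = 1`, minus `s / r`. For fixed `c` these numbers sum
to zero over every constraint, since the conditional expected number of ones is `s`. Some vertex `u`
of each constraint has value 1 with positive probability, and `q u u = 1 - s / r` is nonzero. So the
vectors `q v` in the lexicographically ordered group of real vectors sum to zero on each constraint
without all vanishing. Hence both signs occur, and rounding by sign solves NAE (`hasSAWidth_two`).

Lower bound. A random `r`-uniform hypergraph with linearly many edges is not 2-colorable, so it has
no homomorphism to NAE, while every set of `j` edges, up to a linear size, covers almost `(r - 1) *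
j` vertices (`exists_isSparse_not_colorable`). Such a sparse set of edges always contains one edge,
or two edges sharing a vertex, with so many private vertices that any solution of the rest extends
to it (`exists_removable`). This persists after fixing the values on a set `D` small compared to the
number of edges. Hence the partial maps compatible with every set of at most `K` edges form a
strategy (`consistencyLE_edgeInstance`), with `K` linear in the number of vertices. -/

/-! ### Sherali-Adams width two -/

/-- The number of ones is a linear functional with value `s` at every vertex of the polytope. -/
theorem sum_one_of_mem_polytope {s r : ℕ} {y : Fin r → Fin 2 → ℝ}
    (hy : y ∈ PCSP.polytope ((PCSP.exactlySAT s r).rel ())) : ∑ i, y i 1 = s := by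
  have hconv : Convex ℝ {y : Fin r → Fin 2 → ℝ | ∑ i, y i 1 = s} := by
    intro y hy z hz a b _ _ hab
    simp only [Set.mem_ofPred_eq, Pi.add_apply, Pi.smul_apply, smul_eq_mul] at *
    rw [Finset.sum_add_distrib, ← Finset.mul_sum, ← Finset.mul_sum, hy, hz, ← add_mul, hab,
      one_mul]
  refine convexHull_min ?_ hconv hy
  rintro _ ⟨(t : Fin r → Fin 2), ht, rfl⟩
  have ht' : (Finset.univ.filter fun i => t i = 1).card = s := ht
  have hchar : ∀ i, PCSP.charVec t i 1 = if t i = 1 then 1 else 0 := fun i => by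
    simp [PCSP.charVec]
  change ∑ i : Fin r, PCSP.charVec t i 1 = s
  rw [Finset.sum_congr rfl fun i _ => hchar i, Finset.sum_boole, ht']

theorem dom_empty {A B : Type} [Fintype A] : PCSP.dom (fun _ : A => (none : Option B)) = ∅ := by
  simp [PCSP.dom]

theorem dom_extend_empty {A B : Type} [Fintype A] (c : A) (b : B) :
    PCSP.dom (PCSP.extend (fun _ => none) c b) = {c} := by
  classical
  ext x
  by_cases h : x = c <;> simp [PCSP.dom, PCSP.extend, Function.update_apply, h]

theorem naeSAT_mem_of_sum_eq_zero {G : Type*} [AddCommGroup G] [LinearOrder G]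
    [IsOrderedAddMonoid G] {r : ℕ} (q : Fin r → G) (hsum : ∑ i, q i = 0) (hne : ∃ i, q i ≠ 0) :
    (fun i => if 0 < q i then (1 : Fin 2) else 0) ∈ (PCSP.naeSAT r).rel () := by
  obtain ⟨i₀, hi₀⟩ := hne
  constructor
  · intro h
    refine hi₀ ((Finset.sum_eq_zero_iff_of_nonpos fun i _ => ?_).1 hsum i₀ (Finset.mem_univ _))
    by_contra hi
    have := congrFun h i
    simp [not_le.1 hi] at this
  · intro h
    refine hi₀ ((Finset.sum_eq_zero_iff_of_nonneg fun i _ => ?_).1 hsum i₀ (Finset.mem_univ _))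
    by_contra hi
    have := congrFun h i
    simp [(not_le.1 hi).le.not_gt] at this

/-- Terms that sum to zero and are not all zero have both signs, so the sign is a proper rounding.
Any linearly ordered group serves; a lexicographic one is needed below. -/
theorem homTo_naeSAT_of_sum_eq_zero {G : Type*} [AddCommGroup G] [LinearOrder G]
    [IsOrderedAddMonoid G] {r : ℕ} {I : Type} {J : PCSP.RelStr (PCSP.singleSig r) I} (Q : I → G)
    (hQ : ∀ t : Fin r → I, t ∈ J.rel () → ∑ i, Q (t i) = 0 ∧ ∃ i, Q (t i) ≠ 0) :
    PCSP.HomTo J (PCSP.naeSAT r) :=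
  ⟨fun v => if 0 < Q v then 1 else 0, fun _ t ht =>
    naeSAT_mem_of_sum_eq_zero (fun i => Q (t i)) (hQ t ht).1 (hQ t ht).2⟩

theorem hasSAWidth_two (s r : ℕ) (hs : 0 < s) (hsr : s < r) :
    PCSP.HasSAWidth (PCSP.exactlySAT s r) (PCSP.naeSAT r) (fun _ => 2) := by
  classical
  intro I _ J ⟨x, hx⟩
  have hr0 : (0 : ℝ) < r := by exact_mod_cast hs.trans hsr
  let F : I → I → Option (Fin 2) := fun c => PCSP.extend (fun _ => none) c 1
  -- When `c = 1` has probability zero there is nothing to condition on; the value 0 keeps the sums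
  -- equal to zero.
  let q : I → I → ℝ := fun v c =>
    if 0 < x (F c) then (x (F c))⁻¹ * PCSP.extVal x (F c) v 1 - s / r else 0
  let e := Fintype.equivFin I
  -- The lexicographic order combines all choices of `c`: a nonzero coordinate anywhere makes the
  -- whole vector nonzero.
  let Q : I → Lex (Fin (Fintype.card I) → ℝ) := fun v => toLex fun c => q v (e.symm c)
  refine homTo_naeSAT_of_sum_eq_zero Q fun t ht => ⟨?_, ?_⟩
  · have hsum : ∀ c, ∑ i : Fin r, q (t i) c = 0 := by
      intro c
      by_cases hc : 0 < x (F c)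
      · have h3 := sum_one_of_mem_polytope
          (hx.T3 (F c) (by rw [dom_extend_empty]; simp) () t ht hc)
        simp only [Pi.smul_apply, smul_eq_mul] at h3
        simp only [q, hc, if_true, Finset.sum_sub_distrib, Finset.sum_const, Finset.card_univ,
          Fintype.card_fin, nsmul_eq_mul]
        erw [h3]
        field_simp
        simp
      · simp [q, hc]
    have : ∑ i : Fin r, Q (t i) = toLex (∑ i : Fin r, fun c => q (t i) (e.symm c)) := rfl
    refine this.trans ?_
    have h0 : (∑ i : Fin r, fun c => q (t i) (e.symm c)) = 0 := by
      ext c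
      rw [Finset.sum_apply]
      exact hsum _
    rw [h0]; rfl
  -- Unconditionally the expected number of ones is `s > 0`, so some vertex of the constraint is 1
  -- with positive probability. Conditioning on that same vertex gives `1 - s / r`.
  · have h3 := sum_one_of_mem_polytope
      (hx.T3 (fun _ => none) (by rw [dom_empty]; simp) () t ht (by rw [hx.T1]; exact one_pos))
    rw [hx.T1] at h3
    obtain ⟨i, hi⟩ : ∃ i : Fin r, 0 < x (F (t i)) := by
      by_contra hcon
      push Not at hcon
      have : (s : ℝ) ≤ 0 := by
        rw [← h3]
        refine Finset.sum_nonpos fun i _ => ?_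
        simpa [PCSP.extVal] using hcon i
      exact absurd this (not_le.2 (by exact_mod_cast hs))
    refine ⟨i, fun h0 => ?_⟩
    have h1 : q (t i) (e.symm (e (t i))) = 0 := congrFun (congrArg ofLex h0) (e (t i))
    rw [e.symm_apply_apply] at h1
    have h2 : PCSP.extend (F (t i)) (t i) 1 = F (t i) := by simp [F, PCSP.extend]
    have h4 : F (t i) (t i) = some 1 := by simp [F, PCSP.extend]
    simp only [q, hi, if_true, PCSP.extVal, h4, or_true, h2] at h1
    rw [inv_mul_cancel₀ hi.ne', sub_eq_zero, eq_comm, div_eq_one_iff_eq hr0.ne'] at h1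
    exact hsr.ne (by exact_mod_cast h1)

theorem not_hasBoundedWidth_of_not_hasSublinearWidth {σ : PCSP.Signature} {A B : Type}
    {S : PCSP.RelStr σ A} {T : PCSP.RelStr σ B} (h : ¬ PCSP.HasSublinearWidth S T) :
    ¬ PCSP.HasBoundedWidth S T := by
  rintro ⟨k, hk, hw⟩
  refine h ⟨k, hk.trans_isLittleO ?_, hw⟩
  exact (isLittleO_const_id_atTop (1 : ℝ)).comp_tendsto tendsto_natCast_atTop_atTop

/-- An edge `e` is satisfied by `g` if exactly `s` of its vertices have the value `1`. -/
def ExactlyOn {V : Type} (s : ℕ) (g : V → Fin 2) (e : Finset V) : Prop :=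
  (e.filter fun v => g v = 1).card = s

theorem ExactlyOn.congr {V : Type} {s : ℕ} {g g' : V → Fin 2} {e : Finset V} (h : ExactlyOn s g e)
    (hgg : ∀ v ∈ e, g' v = g v) : ExactlyOn s g' e := by
  unfold ExactlyOn at *
  rw [← h]
  congr 1
  exact Finset.filter_congr fun v hv => by rw [hgg v hv]

/-! ### Peeling edges off sparse hypergraphs -/

section Sparse

variable {V : Type} [DecidableEq V]

/-- The degree of the vertex `v` in the hypergraph `E`. -/
def hdeg (E : Finset (Finset V)) (v : V) : ℕ := (E.filter (v ∈ ·)).card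

/-- The vertices of degree `d` outside `D` of the edge `e` of the hypergraph `E`. -/
def vertsOfDeg (E : Finset (Finset V)) (D : Finset V) (d : ℕ) (e : Finset V) : Finset V :=
  e.filter fun v => v ∉ D ∧ hdeg E v = d

theorem sum_card_filter_eq_sum_hdeg (E E' : Finset (Finset V)) (hE : E' ⊆ E) (p : V → Prop)
    [DecidablePred p] :
    ∑ e ∈ E', (e.filter p).card = ∑ v ∈ (E.sup id).filter p, hdeg E' v := by
  have := Finset.sum_card_bipartiteAbove_eq_sum_card_bipartiteBelow
    (s := E') (t := (E.sup id).filter p) (fun e v => v ∈ e)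
  unfold hdeg
  simp only [Finset.bipartiteAbove, Finset.bipartiteBelow] at this
  rw [← this]
  refine Finset.sum_congr rfl fun e he => congrArg _ ?_
  ext v
  simp only [Finset.mem_filter, Finset.mem_sup, id]
  exact ⟨fun h => ⟨⟨⟨e, hE he, h.1⟩, h.2⟩, h.1⟩, fun h => ⟨h.2, h.1.2⟩⟩

/-- Discharging: each vertex outside `D` distributes a charge of 6 equally over its edges. An edge
receives 6 from a vertex of degree one, 3 from one of degree two, and at most 2 from any other, that
is, 2 plus a bonus of 4, 1 or 0. -/
theorem six_mul_card_sup_le {r : ℕ} (E : Finset (Finset V)) (D : Finset V)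
    (hr : ∀ e ∈ E, e.card = r) :
    6 * (E.sup id).card ≤ 6 * D.card +
      ∑ e ∈ E, (2 * r + 4 * (vertsOfDeg E D 1 e).card + (vertsOfDeg E D 2 e).card) := by
  have hpos : ∀ v ∈ E.sup id, 1 ≤ hdeg E v := by
    intro v hv
    obtain ⟨e, he, hve⟩ := Finset.mem_sup.1 hv
    exact Finset.card_pos.2 ⟨e, Finset.mem_filter.2 ⟨he, hve⟩⟩
  have h0 := sum_card_filter_eq_sum_hdeg E E subset_rfl fun _ => True
  have h1 := sum_card_filter_eq_sum_hdeg E E subset_rfl fun v => v ∉ D ∧ hdeg E v = 1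
  have h2 := sum_card_filter_eq_sum_hdeg E E subset_rfl fun v => v ∉ D ∧ hdeg E v = 2
  simp only [Finset.filter_true] at h0
  rw [Finset.sum_congr rfl hr] at h0
  rw [Finset.sum_filter] at h1 h2
  simp only [vertsOfDeg, Finset.sum_add_distrib, ← Finset.mul_sum]
  have hD : 6 * (E.sup id).card ≤ 6 * D.card + 6 * (E.sup id \ D).card := by
    have := Finset.le_card_sdiff D (E.sup id)
    omega
  refine hD.trans (Nat.add_le_add_left ?_ _)
  rw [h0, h1, h2, Finset.mul_sum, Finset.mul_sum, ← Finset.sum_add_distrib,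
    ← Finset.sum_add_distrib, ← Finset.filter_notMem_eq_sdiff, Finset.card_filter, Finset.mul_sum]
  refine Finset.sum_le_sum fun v hv => ?_
  have := hpos v hv
  by_cases hvD : v ∈ D
  · simp [hvD]
  · simp only [hvD, not_false_eq_true, true_and, if_true]
    split_ifs <;> omega

/-- A pair of removable edges: two edges that meet in a vertex of degree two and have all vertices
but two private. -/
def HasRemovablePair (E : Finset (Finset V)) (D : Finset V) (r : ℕ) : Prop :=
  ∃ e₁ ∈ E, ∃ e₂ ∈ E, e₁ ≠ e₂ ∧ r ≤ (vertsOfDeg E D 1 e₁).card + 2 ∧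
    r ≤ (vertsOfDeg E D 1 e₂).card + 2 ∧ ∃ v ∈ vertsOfDeg E D 2 e₁, v ∈ e₂

theorem card_vertsOfDeg_add_le (E : Finset (Finset V)) (D e : Finset V) :
    (vertsOfDeg E D 1 e).card + (vertsOfDeg E D 2 e).card ≤ e.card := by
  rw [← Finset.card_union_of_disjoint]
  · exact Finset.card_le_card (Finset.union_subset (Finset.filter_subset _ _)
      (Finset.filter_subset _ _))
  · refine Finset.disjoint_left.2 fun v h1 h2 => ?_
    simp only [vertsOfDeg, Finset.mem_filter] at h1 h2
    omega

/-- If no single edge is removable, an edge receives charge at most `2 * r + 4 * (r - 2) + 2 = 6 *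
(r - 1)`, with equality only for `r - 2` private vertices and two of degree two. Expansion makes
nearly all edges tight in this sense. A tight edge whose degree-two neighbors are all non-tight is
costly, so two tight edges meet in a vertex of degree two. -/
theorem exists_removable {r : ℕ} (hr2 : 2 ≤ r) (E : Finset (Finset V)) (D : Finset V)
    (hr : ∀ e ∈ E, e.card = r) (hne : E.Nonempty)
    (hD : 7 * (r + 2) * D.card ≤ E.card)
    (hexp : 7 * (r + 2) * ((r - 1) * E.card) ≤ 7 * (r + 2) * (E.sup id).card + E.card) :
    (∃ e ∈ E, r ≤ (vertsOfDeg E D 1 e).card + 1) ∨ HasRemovablePair E D r := by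
  by_contra hcon
  push Not at hcon
  obtain ⟨hleaf, hpair⟩ := hcon
  set f := fun e => (vertsOfDeg E D 1 e).card with hf
  set g := fun e => (vertsOfDeg E D 2 e).card with hg
  have hfg : ∀ e ∈ E, f e + g e ≤ r := fun e he => hr e he ▸ card_vertsOfDeg_add_le E D e
  have hf2 : ∀ e ∈ E, f e + 2 ≤ r := fun e he => hleaf e he
  set A := E.filter fun e => f e + 2 = r ∧ g e = 2 with hA
  set N := E.filter fun e => ¬ (f e + 2 = r ∧ g e = 2) with hN
  have hAN : A.card + N.card = E.card := Finset.card_filter_add_card_filter_not _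
  have hsix : 6 * (E.sup id).card ≤ 6 * D.card + ∑ e ∈ E, (2 * r + 4 * f e + g e) :=
    six_mul_card_sup_le E D hr
  have hsum : ∑ e ∈ E, (2 * r + 4 * f e + g e) + N.card ≤ E.card * (6 * (r - 1)) := by
    rw [hN, Finset.card_filter, ← Finset.sum_add_distrib]
    refine (Finset.sum_le_card_nsmul _ _ _ fun e he => ?_).trans_eq (smul_eq_mul _ _)
    have := hfg e he
    have := hf2 e he
    split_ifs <;> omega
  -- Without a removable pair, a vertex of degree two outside `D` lies in at most one tight edge,
  -- hence in at least one edge of `N`. Double counting these incidences gives the bound.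
  have hAg : 2 * A.card ≤ r * N.card := by
    have e1 : 2 * A.card = ∑ e ∈ A, g e := by
      rw [Finset.sum_congr rfl fun e he => (Finset.mem_filter.1 he).2.2, Finset.sum_const,
        smul_eq_mul, mul_comm]
    have e2 : ∑ e ∈ N, g e ≤ r * N.card := by
      rw [mul_comm, ← smul_eq_mul, ← Finset.sum_const]
      refine Finset.sum_le_sum fun e he => ?_
      have := hfg e (Finset.mem_filter.1 he).1
      omega
    rw [e1]
    refine le_trans ?_ e2
    simp only [hg, vertsOfDeg]
    rw [sum_card_filter_eq_sum_hdeg E A (Finset.filter_subset _ _)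
        fun v => v ∉ D ∧ hdeg E v = 2,
      sum_card_filter_eq_sum_hdeg E N (Finset.filter_subset _ _) fun v => v ∉ D ∧ hdeg E v = 2]
    refine Finset.sum_le_sum fun v hv => ?_
    obtain ⟨-, hvD, hv2⟩ := Finset.mem_filter.1 hv
    have hadd : hdeg A v + hdeg N v = 2 := by
      rw [← hv2]
      have := Finset.card_filter_add_card_filter_not (s := E.filter (v ∈ ·))
        (fun e => f e + 2 = r ∧ g e = 2)
      simp only [hdeg, hA, hN, Finset.filter_filter] at this ⊢
      simp only [and_comm (b := v ∈ _)]
      exact this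
    have hone : hdeg A v ≤ 1 := by
      refine Finset.card_le_one.2 fun e₁ h₁ e₂ h₂ => ?_
      simp only [hA, Finset.mem_filter] at h₁ h₂
      by_contra hne12
      exact hpair ⟨e₁, h₁.1.1, e₂, h₂.1.1, hne12, h₁.1.2.1.ge, h₂.1.2.1.ge, v,
        Finset.mem_filter.2 ⟨h₁.2, hvD, hv2⟩, h₂.2⟩
    omega
  have hEpos : 0 < E.card := hne.card_pos
  -- With `h1`, the hypotheses on `D` and expansion give `7 * (r + 2) * |N| ≤ 12 * |E|`, whereas
  -- `hAg` gives `2 * |E| ≤ (r + 2) * |N|`. Together `14 * |E| ≤ 12 * |E|`, a contradiction; this is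
  -- where the constant 7 is used.
  have h1 : 6 * (E.sup id).card + N.card ≤ 6 * D.card + E.card * (6 * (r - 1)) := by omega
  obtain ⟨p, rfl⟩ : ∃ p, r = p + 1 := ⟨r - 1, by omega⟩
  simp only [Nat.add_sub_cancel] at *
  zify at *
  nlinarith

theorem exists_exactlyOn_of_free (s : ℕ) (g : V → Fin 2) (e F : Finset V) (hF : F ⊆ e)
    (h1 : ((e \ F).filter fun v => g v = 1).card ≤ s)
    (h2 : s ≤ ((e \ F).filter fun v => g v = 1).card + F.card) :
    ∃ g' : V → Fin 2, (∀ v ∉ F, g' v = g v) ∧ ExactlyOn s g' e := by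
  obtain ⟨W, hWF, hW⟩ := Finset.exists_subset_card_eq
    (s := F) (n := s - ((e \ F).filter fun v => g v = 1).card) (by omega)
  refine ⟨fun v => if v ∈ F then (if v ∈ W then 1 else 0) else g v, fun v hv => by simp [hv], ?_⟩
  have : (e.filter fun v => (if v ∈ F then (if v ∈ W then (1 : Fin 2) else 0) else g v) = 1) =
      ((e \ F).filter fun v => g v = 1) ∪ W := by
    ext v
    have := @hWF v
    have := @hF v
    simp only [Finset.mem_filter, Finset.mem_union, Finset.mem_sdiff]
    by_cases hv : v ∈ F <;> by_cases hw : v ∈ W <;> simp_all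
  unfold ExactlyOn
  rw [this, Finset.card_union_of_disjoint, hW]
  · omega
  · refine Finset.disjoint_left.2 fun v h hv => ?_
    simp only [Finset.mem_filter, Finset.mem_sdiff] at h
    exact h.1.2 (hWF hv)

theorem eq_of_hdeg_eq_one {E : Finset (Finset V)} {v : V} (h : hdeg E v = 1) {e e' : Finset V}
    (he : e ∈ E) (he' : e' ∈ E) (hv : v ∈ e) (hv' : v ∈ e') : e = e' :=
  Finset.card_le_one.1 h.le _ (Finset.mem_filter.2 ⟨he, hv⟩) _ (Finset.mem_filter.2 ⟨he', hv'⟩)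

theorem eq_or_eq_of_hdeg_eq_two {E : Finset (Finset V)} {v : V} (h : hdeg E v = 2)
    {e₁ e₂ e : Finset V} (hne : e₁ ≠ e₂) (h₁ : e₁ ∈ E) (h₂ : e₂ ∈ E) (he : e ∈ E) (hv₁ : v ∈ e₁)
    (hv₂ : v ∈ e₂) (hv : v ∈ e) : e = e₁ ∨ e = e₂ := by
  by_contra hcon
  push Not at hcon
  have : ({e, e₁, e₂} : Finset (Finset V)) ⊆ E.filter (v ∈ ·) := by
    intro a ha
    simp only [Finset.mem_insert, Finset.mem_singleton] at ha
    rcases ha with rfl | rfl | rfl <;> simp [*]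
  have h3 := Finset.card_le_card this
  rw [Finset.card_eq_three.2 ⟨e, e₁, e₂, hcon.1, hcon.2, hne, rfl⟩] at h3
  unfold hdeg at h
  omega

/-- Some assignment agrees with `g₀` on `D` and satisfies all edges of `E`. -/
def SatisfiableFrom (s : ℕ) (D : Finset V) (g₀ : V → Fin 2) (E : Finset (Finset V)) : Prop :=
  ∃ g : V → Fin 2, (∀ v ∈ D, g v = g₀ v) ∧ ∀ e ∈ E, ExactlyOn s g e

/-- With at most one vertex not free, `0 < s < r` leaves room for either value. With two, the values
`1, 1` fail for `s = 1` and the values `0, 0` fail for `s = r - 1`. Giving one of them the value 0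
if `s = 1`, and 1 otherwise, avoids the failing case; for `s = 1` a free vertex is still needed, and
`r > 2` supplies it. -/
theorem exists_exactlyOn_of_private {s r : ℕ} (hs : 0 < s) (hsr : s < r) (hr2 : 2 < r)
    {E : Finset (Finset V)} {D : Finset V} {e : Finset V} (her : e.card = r) (g : V → Fin 2)
    (hfree : r ≤ (vertsOfDeg E D 1 e).card + 1 ∨ r ≤ (vertsOfDeg E D 1 e).card + 2 ∧
      ∃ v ∈ vertsOfDeg E D 2 e, g v = if s = 1 then 0 else 1) :
    ∃ g' : V → Fin 2, (∀ v ∉ vertsOfDeg E D 1 e, g' v = g v) ∧ ExactlyOn s g' e := by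
  have hFe : vertsOfDeg E D 1 e ⊆ e := Finset.filter_subset _ _
  have hcard := Finset.card_sdiff_add_card_eq_card hFe
  have hle := Finset.card_filter_le (e \ vertsOfDeg E D 1 e) fun v => g v = 1
  rcases hfree with h | ⟨h, v, hv, hgv⟩
  · exact exists_exactlyOn_of_free s g e _ hFe (by omega) (by omega)
  · have hv' : v ∈ e \ vertsOfDeg E D 1 e := by
      simp only [vertsOfDeg, Finset.mem_filter, Finset.mem_sdiff] at hv ⊢
      exact ⟨hv.1, fun h' => by omega⟩
    by_cases h1 : s = 1
    · rw [if_pos h1] at hgv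
      have hlt : ((e \ vertsOfDeg E D 1 e).filter fun v => g v = 1).card <
          (e \ vertsOfDeg E D 1 e).card :=
        Finset.card_lt_card (Finset.filter_ssubset.2 ⟨v, hv', by simp [hgv]⟩)
      exact exists_exactlyOn_of_free s g e _ hFe (by omega) (by omega)
    · rw [if_neg h1] at hgv
      have hpos : 0 < ((e \ vertsOfDeg E D 1 e).filter fun v => g v = 1).card :=
        Finset.card_pos.2 ⟨v, Finset.mem_filter.2 ⟨hv', hgv⟩⟩
      exact exists_exactlyOn_of_free s g e _ hFe (by omega) (by omega)

theorem SatisfiableFrom.of_private {s r : ℕ} (hs : 0 < s) (hsr : s < r) (hr2 : 2 < r) {E : Finset (Finset V)}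
    {D : Finset V} {g₀ : V → Fin 2} (hr : ∀ e ∈ E, e.card = r) {e : Finset V} (he : e ∈ E)
    (hfree : r ≤ (vertsOfDeg E D 1 e).card + 1)
    (hsat : SatisfiableFrom s D g₀ (E.erase e)) : SatisfiableFrom s D g₀ E := by
  obtain ⟨g, hgD, hg⟩ := hsat
  obtain ⟨g', hg', hge⟩ := exists_exactlyOn_of_private hs hsr hr2 (hr e he) g (Or.inl hfree)
  refine ⟨g', fun v hv => ?_, fun a ha => ?_⟩
  · rw [hg' v (by simp [vertsOfDeg, hv]), hgD v hv]
  · by_cases hae : a = e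
    · exact hae ▸ hge
    · refine (hg a (Finset.mem_erase.2 ⟨hae, ha⟩)).congr fun v hv => hg' v fun h => hae ?_
      obtain ⟨hve, -, hv1⟩ := Finset.mem_filter.1 h
      exact eq_of_hdeg_eq_one hv1 ha he hv hve

/-- The common vertex `v` lies in no other edge, so it can be reset to the value that suits both
edges. Each edge is then completed on its own private vertices, without disturbing any other edge.
-/
theorem SatisfiableFrom.of_removablePair {s r : ℕ} (hs : 0 < s) (hsr : s < r) (hr2 : 2 < r)
    {E : Finset (Finset V)} {D : Finset V} {g₀ : V → Fin 2} (hr : ∀ e ∈ E, e.card = r)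
    {e₁ e₂ : Finset V} (h₁ : e₁ ∈ E) (h₂ : e₂ ∈ E) (hne : e₁ ≠ e₂)
    (hf₁ : r ≤ (vertsOfDeg E D 1 e₁).card + 2) (hf₂ : r ≤ (vertsOfDeg E D 1 e₂).card + 2)
    {v : V} (hv₁ : v ∈ vertsOfDeg E D 2 e₁) (hv₂ : v ∈ e₂)
    (hsat : SatisfiableFrom s D g₀ ((E.erase e₁).erase e₂)) : SatisfiableFrom s D g₀ E := by
  obtain ⟨g, hgD, hg⟩ := hsat
  obtain ⟨hve₁, hvD, hv⟩ := Finset.mem_filter.1 hv₁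
  set c : Fin 2 := if s = 1 then 0 else 1 with hc
  obtain ⟨g₁, hg₁, hge₁⟩ := exists_exactlyOn_of_private hs hsr hr2 (hr e₁ h₁) (Function.update g v c)
    (Or.inr ⟨hf₁, v, hv₁, by simp [hc]⟩)
  have hvf : ∀ e, v ∉ vertsOfDeg E D 1 e := fun e h => by
    have := (Finset.mem_filter.1 h).2.2
    omega
  obtain ⟨g₂, hg₂, hge₂⟩ := exists_exactlyOn_of_private hs hsr hr2 (hr e₂ h₂) g₁
    (Or.inr ⟨hf₂, v, Finset.mem_filter.2 ⟨hv₂, hvD, hv⟩, by simp [hg₁ v (hvf _), hc]⟩)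
  refine ⟨g₂, fun u hu => ?_, fun a ha => ?_⟩
  · rw [hg₂ u (by simp [vertsOfDeg, hu]), hg₁ u (by simp [vertsOfDeg, hu]),
      Function.update_of_ne (ne_of_mem_of_not_mem hu hvD), hgD u hu]
  · have hmiss : ∀ e ∈ E, a ≠ e → ∀ u ∈ a, u ∉ vertsOfDeg E D 1 e := fun e he hae u hu h => by
      obtain ⟨hue, -, hu1⟩ := Finset.mem_filter.1 h
      exact hae (eq_of_hdeg_eq_one hu1 ha he hu hue)
    by_cases ha₂ : a = e₂
    · exact ha₂ ▸ hge₂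
    by_cases ha₁ : a = e₁
    · subst ha₁
      exact hge₁.congr fun u hu => hg₂ u (hmiss e₂ h₂ ha₂ u hu)
    refine (hg a (by simp [*])).congr fun u hu => ?_
    rw [hg₂ u (hmiss e₂ h₂ ha₂ u hu), hg₁ u (hmiss e₁ h₁ ha₁ u hu), Function.update_of_ne]
    rintro rfl
    rcases eq_or_eq_of_hdeg_eq_two hv hne h₁ h₂ ha hve₁ hv₂ hu with h | h <;> contradiction

/-- Small sets of edges of the `r`-uniform hypergraph `E` are nearly vertex-disjoint up to
one common vertex per edge. -/
def IsSparse (r L : ℕ) (E : Finset (Finset V)) : Prop :=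
  ∀ E' ⊆ E, E'.card ≤ L →
    7 * (r + 2) * ((r - 1) * E'.card) ≤ 7 * (r + 2) * (E'.sup id).card + E'.card

/-- As long as more than `K` edges remain, `D` is small relative to them and something can be peeled
off; peeling stops at a set that is satisfiable by assumption. -/
theorem SatisfiableFrom.of_small {s r K L : ℕ} (hs : 0 < s) (hsr : s < r) (hr2 : 2 < r) {E : Finset (Finset V)}
    (hr : ∀ e ∈ E, e.card = r) (hE : IsSparse r L E) {D : Finset V} {g₀ : V → Fin 2}
    (hD : 7 * (r + 2) * D.card ≤ K)
    (hsmall : ∀ E' ⊆ E, E'.card ≤ K → SatisfiableFrom s D g₀ E') :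
    ∀ E' ⊆ E, E'.card ≤ L → SatisfiableFrom s D g₀ E' := by
  intro E'
  induction E' using Finset.strongInduction with
  | H E' ih =>
    intro hsub hcard
    by_cases hK : E'.card ≤ K
    · exact hsmall E' hsub hK
    have hr' : ∀ e ∈ E', e.card = r := fun e he => hr e (hsub he)
    have step : ∀ E'', E'' ⊂ E' → SatisfiableFrom s D g₀ E'' := fun E'' h =>
      ih E'' h (h.subset.trans hsub) ((Finset.card_le_card h.subset).trans hcard)
    rcases exists_removable (by omega) E' D hr' (Finset.card_pos.1 (by omega)) (by omega)
      (hE E' hsub hcard) with ⟨e, he, hfree⟩ | ⟨e₁, h₁, e₂, h₂, hne, hf₁, hf₂, v, hv₁, hv₂⟩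
    · exact .of_private hs hsr hr2 hr' he hfree (step _ (Finset.erase_ssubset he))
    · exact .of_removablePair hs hsr hr2 hr' h₁ h₂ hne hf₁ hf₂ hv₁ hv₂
        (step _ ((Finset.erase_subset _ _).trans_ssubset (Finset.erase_ssubset h₁)))

end Sparse

/-! ### Strategies on sparse instances -/

/-- The instance whose constraints are the edges of `E`, with all orderings. -/
def edgeInstance (r : ℕ) {V : Type} [DecidableEq V] (E : Finset (Finset V)) :
    PCSP.RelStr (PCSP.singleSig r) V where
  rel := fun _ => {t : Fin r → V | Function.Injective t ∧ Finset.univ.image t ∈ E}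

/-- The strategy consists of the maps on at most `k` points that are compatible with every set of at
most `K` edges. Peeling raises `K` to `2 * K`, which is what extension to a Boolean value requires.
-/
theorem consistencyLE_edgeInstance {V : Type} [Fintype V] [DecidableEq V] {s r k K : ℕ}
    (hs : 0 < s) (hsr : s < r) (hr2 : 2 < r) (hK : 0 < K) (hk : 7 * (r + 2) * k ≤ K) {E : Finset (Finset V)}
    (hr : ∀ e ∈ E, e.card = r) (hE : IsSparse r (2 * K) E) :
    PCSP.ConsistencyLE k (edgeInstance r E) (PCSP.exactlySAT s r) := by
  classical
  let g₀ : (V → Option (Fin 2)) → V → Fin 2 := fun h v => (h v).getD 0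
  have hmem : ∀ (h : V → Option (Fin 2)) v, v ∈ PCSP.dom h ↔ (h v).isSome = true := by
    simp [PCSP.dom]
  have hg₀ : ∀ (h : V → Option (Fin 2)) v b, h v = some b → g₀ h v = b := fun h v b hb => by
    simp [g₀, hb]
  refine ⟨{h | (PCSP.dom h).card ≤ k ∧ ∀ E' ⊆ E, E'.card ≤ K →
    SatisfiableFrom s (PCSP.dom h) (g₀ h) E'}, ⟨?_, ?_, ?_, ?_⟩⟩
  · have hdom : PCSP.dom (fun _ : V => (none : Option (Fin 2))) = ∅ := by simp [PCSP.dom]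
    refine ⟨fun _ => none, by rw [hdom]; simp, ?_⟩
    -- For the empty map `D` is empty, so peeling can go down to no edges at all.
    refine fun E' hsub h => SatisfiableFrom.of_small (K := 0) hs hsr hr2 hr hE (by rw [hdom]; simp)
      (fun E'' _ h0 => ?_) E' hsub (by omega)
    rw [Finset.card_eq_zero.1 (Nat.le_zero.1 h0)]
    exact ⟨_, fun _ _ => rfl, by simp⟩
  · rintro h ⟨-, hh⟩ R t ⟨hinj, ht⟩ a ha
    obtain ⟨g, hgD, hg⟩ := hh {Finset.univ.image t} (by simpa using ht)
      (by rw [Finset.card_singleton]; exact hK)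
    have h1 := hg _ (Finset.mem_singleton_self _)
    have h2 : ∀ i, g (t i) = a i := fun i => by
      rw [hgD _ ((hmem _ _).2 (by simp [ha i])), hg₀ _ _ _ (ha i)]
    change (Finset.univ.filter fun i => a i = 1).card = s
    rw [← h1, Finset.filter_image, Finset.card_image_of_injective _ hinj]
    simp_rw [h2]
  · rintro h ⟨hc, hh⟩ f hfh
    have hsub : PCSP.dom f ⊆ PCSP.dom h := fun v hv => by
      obtain ⟨b, hb⟩ := Option.isSome_iff_exists.1 ((hmem _ _).1 hv)
      exact (hmem _ _).2 (by simp [hfh v b hb])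
    refine ⟨(Finset.card_le_card hsub).trans hc, fun E' hE' hc' => ?_⟩
    obtain ⟨g, hgD, hg⟩ := hh E' hE' hc'
    refine ⟨g, fun v hv => ?_, hg⟩
    obtain ⟨b, hb⟩ := Option.isSome_iff_exists.1 ((hmem _ _).1 hv)
    rw [hgD v (hsub hv), hg₀ _ _ _ hb, hg₀ _ _ _ (hfh v b hb)]
  · rintro h ⟨hc, hh⟩ hlt x hx
    by_contra hcon
    push Not at hcon
    have hdom : ∀ b, PCSP.dom (PCSP.extend h x b) = insert x (PCSP.dom h) := fun b => by
      ext v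
      by_cases hv : v = x <;> simp [hmem, PCSP.extend, hv]
    have hbad : ∀ b, ∃ E' ⊆ E, E'.card ≤ K ∧
        ¬ SatisfiableFrom s (insert x (PCSP.dom h)) (g₀ (PCSP.extend h x b)) E' := fun b => by
      have := hcon b
      simp only [Set.mem_ofPred_eq, not_and, hdom, Finset.card_insert_of_notMem hx] at this
      have := this (by omega)
      push Not at this
      exact this
    choose E' hsub hcard hunsat using hbad
    -- If each of the two values at `x` is refuted by at most `K` edges, the union of both
    -- refutations has at most `2 * K` edges and is still satisfiable from `h`. The value `g x` of a
    -- solution contradicts its own refutation.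
    obtain ⟨g, hgD, hg⟩ := SatisfiableFrom.of_small hs hsr hr2 hr hE
      ((Nat.mul_le_mul_left _ hc).trans hk) hh (E' 0 ∪ E' 1)
      (Finset.union_subset (hsub 0) (hsub 1))
      ((Finset.card_union_le _ _).trans (by have := hcard 0; have := hcard 1; omega))
    refine hunsat (g x) ⟨g, fun v hv => ?_, fun e he => hg e ?_⟩
    · by_cases hvx : v = x
      · subst hvx; exact (hg₀ _ _ _ (by simp [PCSP.extend])).symm
      · rw [hgD v ((Finset.mem_insert.1 hv).resolve_left hvx)]
        simp [g₀, PCSP.extend, hvx]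
    · have : g x = 0 ∨ g x = 1 := by omega
      rcases this with h0 | h0 <;> rw [h0] at he <;> simp [he]

theorem not_homTo_naeSAT {V : Type} [DecidableEq V] {r : ℕ} {E : Finset (Finset V)}
    (hr : ∀ e ∈ E, e.card = r) (hE : ∀ g : V → Fin 2, ∃ e ∈ E, ∃ c, ∀ v ∈ e, g v = c) :
    ¬ PCSP.HomTo (edgeInstance r E) (PCSP.naeSAT r) := by
  rintro ⟨g, hg⟩
  obtain ⟨e, he, c, hc⟩ := hE g
  let t : Fin r → V := fun i => ((e.equivFinOfCardEq (hr e he)).symm i : V)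
  have himg : Finset.univ.image t = e := by
    ext v
    simp only [Finset.mem_image, Finset.mem_univ, true_and]
    constructor
    · rintro ⟨i, rfl⟩
      exact ((e.equivFinOfCardEq (hr e he)).symm i).2
    · exact fun hv => ⟨e.equivFinOfCardEq (hr e he) ⟨v, hv⟩, by simp [t]⟩
  have ht : t ∈ (edgeInstance r E).rel () :=
    ⟨Subtype.val_injective.comp (Equiv.injective _), himg ▸ he⟩
  have hconst : ∀ i, g (t i) = c := fun i => hc _ ((e.equivFinOfCardEq (hr e he)).symm i).2
  obtain ⟨h0, h1⟩ := hg () t ht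
  have : c = 0 ∨ c = 1 := by omega
  rcases this with rfl | rfl
  · exact h0 (funext hconst)
  · exact h1 (funext hconst)

/-! ### Binomial estimates for the union bound -/

theorem choose_mul_pow_self_le (n k : ℕ) : n.choose k * k ^ k ≤ (3 * n) ^ k := by
  have h1 : (n.choose k : ℝ) ≤ (n : ℝ) ^ k / k.factorial := Nat.choose_le_pow_div k n
  have h2 : (k : ℝ) ^ k / k.factorial ≤ 3 ^ k := by
    refine (Real.pow_div_factorial_le_exp _ (Nat.cast_nonneg k) k).trans ?_
    rw [← mul_one (k : ℝ), Real.exp_nat_mul]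
    exact pow_le_pow_left₀ (Real.exp_pos 1).le Real.exp_one_lt_three.le k
  have h3 : (n.choose k * k ^ k : ℝ) ≤ (3 * n) ^ k := by
    calc (n.choose k * k ^ k : ℝ) ≤ (n : ℝ) ^ k / k.factorial * k ^ k := by gcongr
      _ = n ^ k * ((k : ℝ) ^ k / k.factorial) := by ring
      _ ≤ n ^ k * 3 ^ k := by gcongr
      _ = (3 * n) ^ k := by rw [mul_pow, mul_comm]
  exact_mod_cast h3

/-- A random `r`-set lies in a given `t`-set with probability at most `(2 * t / n) ^ r`, because `n
+ 1 - r ≥ n / 2`. -/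
theorem choose_mul_pow_le {n t r : ℕ} (h : 2 * r ≤ n) :
    t.choose r * n ^ r ≤ n.choose r * (2 * t) ^ r := by
  refine Nat.le_of_mul_le_mul_left ?_ r.factorial_pos
  calc r.factorial * (t.choose r * n ^ r) = t.descFactorial r * n ^ r := by
        rw [Nat.descFactorial_eq_factorial_mul_choose, mul_assoc]
    _ ≤ t ^ r * (2 * (n + 1 - r)) ^ r := by
        gcongr
        · exact Nat.descFactorial_le_pow _ _
        · omega
    _ = (n + 1 - r) ^ r * (2 * t) ^ r := by simp only [mul_pow]; ring
    _ ≤ n.descFactorial r * (2 * t) ^ r := by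
        gcongr
        exact Nat.pow_sub_le_descFactorial _ _
    _ = r.factorial * (n.choose r * (2 * t) ^ r) := by
        rw [Nat.descFactorial_eq_factorial_mul_choose, mul_assoc]

theorem choose_two_mul_le {N r : ℕ} (h : 2 * r ≤ N) :
    (2 * N).choose r ≤ 4 ^ r * N.choose r := by
  rcases Nat.eq_zero_or_pos N with rfl | hN
  · obtain rfl : r = 0 := by omega
    simp
  refine Nat.le_of_mul_le_mul_right (c := N ^ r) ?_ (by positivity)
  refine (choose_mul_pow_le (t := 2 * N) h).trans_eq ?_
  rw [← mul_assoc, mul_pow, mul_pow, show 4 = 2 * 2 from rfl, mul_pow]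
  ring

/-- The expected number of choices of `j` random edges and `t` vertices containing them is at most
`4 ^ (-j)`. The powers of `n` cancel except for `n ^ (-a)`, where `a` is the deficit of `t` from `(r
- 1) * j`. -/
theorem union_bound_term {n m r q a t j C M : ℕ} (hC : 0 < C) (hj : 0 < j) (hr : 0 < r)
    (ht : 0 < t) (hn : 2 * r ≤ n) (hm : m = C * n) (hta : t + j + a = r * j) (hja : j ≤ q * a)
    (hM : M = (12 * C * 6 ^ r * r) ^ q * r) (hjn : j * M ≤ n) :
    m.choose j * n.choose t * t.choose r ^ j * 4 ^ j ≤ n.choose r ^ j := by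
  have hn0 : 0 < n := by omega
  have htr : t ≤ r * j := by omega
  set W := 12 * C * 6 ^ r * r with hW
  have hW1 : 1 ≤ W := Nat.one_le_iff_ne_zero.2 (by positivity)
  -- The constant `W` collects every factor of exponential growth in `j`. Since `j ≤ q * a`, even a
  -- deficit of a `1 / q` fraction of the edges absorbs it once `n ≥ j * W ^ q * r`.
  have main : W ^ j * (r * j) ^ a ≤ n ^ a := by
    calc W ^ j * (r * j) ^ a ≤ W ^ (q * a) * (r * j) ^ a := by gcongr
      _ = (j * M) ^ a := by rw [hM, pow_mul, ← mul_pow]; ring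
      _ ≤ n ^ a := by gcongr
  have key : (3 * m) ^ j * (3 * n) ^ t * (2 * t) ^ (r * j) * 4 ^ j ≤
      j ^ j * t ^ t * n ^ (r * j) := by
    calc (3 * m) ^ j * (3 * n) ^ t * (2 * t) ^ (r * j) * 4 ^ j
        = (12 * C) ^ j * 3 ^ t * 2 ^ (r * j) * (t ^ j * t ^ a) * (t ^ t * n ^ (j + t)) := by
          rw [hm, ← hta]
          simp only [mul_pow, pow_add, show 12 = 3 * 4 from rfl]
          ring
      _ ≤ (12 * C) ^ j * 3 ^ (r * j) * 2 ^ (r * j) * ((r * j) ^ j * (r * j) ^ a) *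
          (t ^ t * n ^ (j + t)) := by gcongr; norm_num
      _ = W ^ j * (r * j) ^ a * (j ^ j * (t ^ t * n ^ (j + t))) := by
          rw [hW, show 6 = 3 * 2 from rfl]
          simp only [mul_pow, pow_mul]
          ring
      _ ≤ n ^ a * (j ^ j * (t ^ t * n ^ (j + t))) := by gcongr
      _ = j ^ j * t ^ t * n ^ (r * j) := by rw [← hta]; simp only [pow_add]; ring
  have h1 := choose_mul_pow_self_le m j
  have h2 := choose_mul_pow_self_le n t
  have h3 : t.choose r ^ j * n ^ (r * j) ≤ n.choose r ^ j * (2 * t) ^ (r * j) := by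
    rw [pow_mul, pow_mul, ← mul_pow, ← mul_pow]
    exact Nat.pow_le_pow_left (choose_mul_pow_le hn) j
  refine Nat.le_of_mul_le_mul_right (c := j ^ j * t ^ t * n ^ (r * j)) ?_ (by positivity)
  calc m.choose j * n.choose t * t.choose r ^ j * 4 ^ j * (j ^ j * t ^ t * n ^ (r * j))
      = (m.choose j * j ^ j) * (n.choose t * t ^ t) * (t.choose r ^ j * n ^ (r * j)) * 4 ^ j := by
        ring
    _ ≤ (3 * m) ^ j * (3 * n) ^ t * (n.choose r ^ j * (2 * t) ^ (r * j)) * 4 ^ j := by gcongr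
    _ = n.choose r ^ j * ((3 * m) ^ j * (3 * n) ^ t * (2 * t) ^ (r * j) * 4 ^ j) := by ring
    _ ≤ n.choose r ^ j * (j ^ j * t ^ t * n ^ (r * j)) := by gcongr

/-! ### Random hypergraphs -/

/-- All sequences of `m` edges of cardinality `r` on `n` vertices. -/
def edgeSeqs (m n r : ℕ) : Finset (Fin m → Finset (Fin n)) :=
  Fintype.piFinset fun _ => Finset.univ.powersetCard r

theorem card_edgeSeqs (m n r : ℕ) : (edgeSeqs m n r).card = n.choose r ^ m := by
  simp [edgeSeqs]

open Classical in
/-- The sequences of edges with `j` terms that are contained in a set of `t` vertices. -/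
def denseSeqs (m n r j t : ℕ) : Finset (Fin m → Finset (Fin n)) :=
  (edgeSeqs m n r).filter fun ω => ∃ S : Finset (Fin m), S.card = j ∧
    ∃ T : Finset (Fin n), T.card = t ∧ ∀ i ∈ S, ω i ⊆ T

/-- Union bound over the positions `S` and the vertex set `T`; the remaining `m - j` edges are
arbitrary. -/
theorem card_denseSeqs_le (m n r j t : ℕ) :
    (denseSeqs m n r j t).card * n.choose r ^ j ≤
      m.choose j * n.choose t * t.choose r ^ j * n.choose r ^ m := by
  classical
  by_cases hjm : m < j
  · have : denseSeqs m n r j t = ∅ := by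
      refine Finset.filter_eq_empty_iff.2 ?_
      rintro ω - ⟨S, hS, -⟩
      have := S.card_le_univ
      simp at this
      omega
    simp [this]
  push Not at hjm
  let P : Finset (Fin m) × Finset (Fin n) → Finset (Fin m → Finset (Fin n)) := fun x =>
    Fintype.piFinset fun i => if i ∈ x.1 then x.2.powersetCard r else Finset.univ.powersetCard r
  let I := (Finset.univ : Finset (Fin m)).powersetCard j ×ˢ
    (Finset.univ : Finset (Fin n)).powersetCard t
  have hsub : denseSeqs m n r j t ⊆ I.biUnion P := by
    intro ω hω
    obtain ⟨hω, S, hS, T, hT, h⟩ := Finset.mem_filter.1 hω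
    refine Finset.mem_biUnion.2 ⟨(S, T), by simp [I, hS, hT], Fintype.mem_piFinset.2 fun i => ?_⟩
    have hi := Fintype.mem_piFinset.1 hω i
    by_cases hiS : i ∈ S
    · simpa [hiS, Finset.mem_powersetCard, h i hiS] using hi
    · simpa [hiS] using hi
  have hP : ∀ x ∈ I, (P x).card ≤ t.choose r ^ j * n.choose r ^ (m - j) := by
    rintro ⟨S, T⟩ hx
    simp only [I, Finset.mem_product, Finset.mem_powersetCard_univ] at hx
    have hcompl : (Finset.univ.filter fun i => i ∉ S).card = m - j := by
      have := Finset.card_compl S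
      rw [Fintype.card_fin, hx.1] at this
      rw [← this]
      congr 1
      ext i
      simp
    simp only [P, Fintype.card_piFinset, apply_ite Finset.card, Finset.card_powersetCard, hx.2,
      Finset.card_univ, Fintype.card_fin, Finset.prod_ite, Finset.prod_const, hcompl,
      Finset.filter_univ_mem, hx.1]
    exact le_rfl
  have hcard := (Finset.card_le_card hsub).trans (Finset.card_biUnion_le_card_mul I P _ hP)
  have hI : I.card = m.choose j * n.choose t := by simp [I]
  rw [hI] at hcard
  calc (denseSeqs m n r j t).card * n.choose r ^ j
      ≤ m.choose j * n.choose t * (t.choose r ^ j * n.choose r ^ (m - j)) * n.choose r ^ j := by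
        gcongr
    _ = m.choose j * n.choose t * t.choose r ^ j * n.choose r ^ (m - j + j) := by
        rw [pow_add]; ring
    _ = _ := by rw [Nat.sub_add_cancel hjm]

open Classical in
/-- The sequences of edges none of which is monochromatic in some two-coloring. -/
def colorableSeqs (m n r : ℕ) : Finset (Fin m → Finset (Fin n)) :=
  (edgeSeqs m n r).filter fun ω => ∃ g : Fin n → Fin 2, ∀ i, ¬ ∃ c, ∀ v ∈ ω i, g v = c

/-- The larger color class has at least half of the vertices and so contains at least a `4 ^ (-r)`
fraction of all `r`-sets. -/
theorem choose_le_mul_card_monochromatic {N r : ℕ} (h : 2 * r ≤ N) (g : Fin (2 * N) → Fin 2)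
    [DecidablePred fun e : Finset (Fin (2 * N)) => ∃ c, ∀ v ∈ e, g v = c] :
    (2 * N).choose r ≤ 4 ^ r *
      ((Finset.univ.powersetCard r).filter fun e => ∃ c, ∀ v ∈ e, g v = c).card := by
  classical
  obtain ⟨c, hc⟩ : ∃ c, N ≤ (Finset.univ.filter fun v => g v = c).card := by
    by_contra hcon
    push Not at hcon
    have := Finset.card_eq_sum_card_fiberwise (f := g) (s := Finset.univ) (t := Finset.univ)
      (by simp)
    rw [Fin.sum_univ_two] at this
    have h0 := hcon 0
    have h1 := hcon 1
    simp only [Finset.card_univ, Fintype.card_fin] at this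
    omega
  refine (choose_two_mul_le h).trans (Nat.mul_le_mul_left _ ?_)
  refine (Nat.choose_le_choose r hc).trans ?_
  rw [← Finset.card_powersetCard]
  refine Finset.card_le_card fun e he => ?_
  obtain ⟨hsub, hcard⟩ := Finset.mem_powersetCard.1 he
  exact Finset.mem_filter.2 ⟨Finset.mem_powersetCard_univ.2 hcard, c,
    fun v hv => (Finset.mem_filter.1 (hsub hv)).2⟩

/-- A fixed coloring is proper with probability at most `exp (-m / 4 ^ r) = exp (-2 * n) ≤ 4 ^
(-n)`, and there are `2 ^ n` colorings. -/
theorem card_colorableSeqs_le {N r n m : ℕ} (h : 2 * r ≤ N) (hN : 0 < N) (hn : n = 2 * N)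
    (hm : m = 2 * 4 ^ r * n) :
    ((colorableSeqs m n r).card : ℝ) ≤ (n.choose r : ℝ) ^ m / 2 := by
  classical
  let G : (Fin n → Fin 2) → Finset (Finset (Fin n)) := fun g =>
    (Finset.univ.powersetCard r).filter fun e => ¬ ∃ c, ∀ v ∈ e, g v = c
  have hG : ∀ g, ((G g).card : ℝ) ≤ n.choose r * Real.exp (-(1 / 4 ^ r)) := by
    intro g
    have h1 := Finset.card_filter_add_card_filter_not
      (s := (Finset.univ : Finset (Fin n)).powersetCard r) (fun e => ∃ c, ∀ v ∈ e, g v = c)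
    rw [Finset.card_powersetCard, Finset.card_univ, Fintype.card_fin] at h1
    have h2 : n.choose r ≤ 4 ^ r *
        ((Finset.univ.powersetCard r).filter fun e => ∃ c, ∀ v ∈ e, g v = c).card := by
      subst hn
      exact choose_le_mul_card_monochromatic h g
    have h1' : (((Finset.univ.powersetCard r).filter fun e => ∃ c, ∀ v ∈ e, g v = c).card : ℝ) +
        (G g).card = n.choose r := by exact_mod_cast h1
    have h2' : (n.choose r : ℝ) ≤ 4 ^ r *
      ((Finset.univ.powersetCard r).filter fun e => ∃ c, ∀ v ∈ e, g v = c).card := by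
      exact_mod_cast h2
    have h3 : (n.choose r : ℝ) * (1 / 4 ^ r) ≤
        ((Finset.univ.powersetCard r).filter fun e => ∃ c, ∀ v ∈ e, g v = c).card := by
      rw [mul_one_div, div_le_iff₀ (by positivity), mul_comm]
      exact h2'
    calc ((G g).card : ℝ) ≤ n.choose r * (1 - 1 / 4 ^ r) := by linarith
      _ ≤ _ := by gcongr; exact Real.one_sub_le_exp_neg _
  have hsub : colorableSeqs m n r ⊆
      (Finset.univ : Finset (Fin n → Fin 2)).biUnion fun g => Fintype.piFinset fun _ => G g := by
    intro ω hω
    obtain ⟨hω, g, hg⟩ := Finset.mem_filter.1 hω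
    exact Finset.mem_biUnion.2 ⟨g, Finset.mem_univ _, Fintype.mem_piFinset.2 fun i =>
      Finset.mem_filter.2 ⟨Fintype.mem_piFinset.1 hω i, hg i⟩⟩
  have hcard := (Finset.card_le_card hsub).trans Finset.card_biUnion_le
  simp only [Fintype.card_piFinset, Finset.prod_const, Finset.card_univ, Fintype.card_fin] at hcard
  have hexp : Real.exp (-(1 / 4 ^ r)) ^ m ≤ (1 / 4) ^ n := by
    rw [← Real.exp_nat_mul, hm]
    have : ((2 * 4 ^ r * n : ℕ) : ℝ) * -(1 / 4 ^ r) = n * (-1 + -1) := by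
      push_cast
      field_simp
      ring
    rw [this, Real.exp_nat_mul, Real.exp_add]
    have h2 : Real.exp (-1) ≤ 1 / 2 := by
      rw [Real.exp_neg, ← one_div]
      exact one_div_le_one_div_of_le two_pos (by have := Real.add_one_le_exp 1; linarith)
    refine pow_le_pow_left₀ (by positivity) ?_ n
    nlinarith [Real.exp_pos (-1)]
  calc ((colorableSeqs m n r).card : ℝ) ≤ ∑ g : Fin n → Fin 2, ((G g).card : ℝ) ^ m := by
        exact_mod_cast hcard
    _ ≤ ∑ _g : Fin n → Fin 2, (n.choose r : ℝ) ^ m * (1 / 4) ^ n := by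
        refine Finset.sum_le_sum fun g _ => ?_
        refine (pow_le_pow_left₀ (by positivity) (hG g) m).trans ?_
        rw [mul_pow]
        gcongr
    _ = (n.choose r : ℝ) ^ m * (1 / 2) ^ n := by
        simp only [Finset.sum_const, Finset.card_univ, Fintype.card_fun, Fintype.card_fin,
          nsmul_eq_mul]
        push_cast
        rw [mul_left_comm, ← mul_pow]
        norm_num
    _ ≤ (n.choose r : ℝ) ^ m * (1 / 2) ^ 1 := by
        gcongr ?_ * ?_
        exact pow_le_pow_of_le_one (by norm_num) (by norm_num) (by omega)
    _ = _ := by ring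

/-- A set of `j` edges violates sparsity if and only if it covers at most this many vertices. -/
def sparseBound (r j : ℕ) : ℕ := r * j - j - (j + 7 * (r + 2) - 1) / (7 * (r + 2))

theorem sparseBound_spec {r j : ℕ} (hr : 3 ≤ r) (hj : 0 < j) :
    0 < sparseBound r j ∧ ∃ a, sparseBound r j + j + a = r * j ∧
      7 * (r + 2) * a < j + 7 * (r + 2) ∧ j ≤ 7 * (r + 2) * a := by
  unfold sparseBound
  set q := 7 * (r + 2) with hq
  set a := (j + q - 1) / q with ha
  have hq0 : 0 < q := by omega
  have ha1 : q * a ≤ j + q - 1 := Nat.mul_div_le (j + q - 1) q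
  have ha2 : j + q - 1 < q * (a + 1) := Nat.lt_mul_div_succ (j + q - 1) hq0
  rw [mul_add] at ha2
  have haj : a ≤ j := by
    have h1 : q * a < q * (j + 1) := by
      have : j ≤ q * j := Nat.le_mul_of_pos_left _ hq0
      rw [mul_add]
      omega
    have := Nat.lt_of_mul_lt_mul_left h1
    omega
  have h3 : 3 * j ≤ r * j := Nat.mul_le_mul_right j hr
  exact ⟨by omega, a, by omega, by omega, by omega⟩

theorem isSparse_of_notMem_denseSeqs {r m n L : ℕ} (hr : 3 ≤ r) (hL : r * L ≤ n)
    {ω : Fin m → Finset (Fin n)} (hω : ω ∈ edgeSeqs m n r)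
    (h : ∀ j, 0 < j → j ≤ L → ω ∉ denseSeqs m n r j (sparseBound r j)) :
    IsSparse r L (Finset.univ.image ω) := by
  classical
  intro E' hE' hcard
  by_contra hcon
  push Not at hcon
  set j := E'.card with hj
  have hj0 : 0 < j := by
    by_contra h0
    simp [Nat.eq_zero_of_not_pos h0] at hcon
  obtain ⟨-, a, ht, ha1, ha2⟩ := sparseBound_spec hr hj0
  set t := sparseBound r j
  set q := 7 * (r + 2)
  have hta : (r - 1) * j = t + a := by
    rw [Nat.sub_mul]
    omega
  have hUt : (E'.sup id).card ≤ t := by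
    have : q * (E'.sup id).card < q * (t + 1) := by
      rw [hta, mul_add] at hcon
      rw [mul_add]
      omega
    have := Nat.lt_of_mul_lt_mul_left this
    omega
  have htn : t ≤ n := by
    have := Nat.mul_le_mul_left r hcard
    omega
  -- A violating set covers at most `t` vertices; its union is padded to exactly `t`, and its
  -- distinct edges are lifted to distinct positions in the sequence.
  obtain ⟨T, hUT, -, hT⟩ := Finset.exists_subsuperset_card_eq (Finset.subset_univ (E'.sup id)) hUt
    (by simpa using htn)
  obtain ⟨S, -, hinj, hSE⟩ := Finset.exists_subset_injOn_image_eq_of_surjOn (f := ω) Set.univ E'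
    fun e he => by simpa using hE' he
  refine h j hj0 hcard
    (Finset.mem_filter.2 ⟨hω, S, ?_, T, hT, fun i hi => ?_⟩)
  · rw [hj, ← hSE, Finset.card_image_of_injOn hinj]
  · refine (Finset.le_sup (f := id) ?_ : ω i ≤ E'.sup id).trans hUT
    rw [← hSE]
    exact Finset.mem_image_of_mem _ hi

theorem sum_quarter_pow_lt (L : ℕ) : ∑ j ∈ Finset.range L, (1 / 4 : ℝ) ^ (j + 1) < 1 / 2 := by
  have : ∀ L : ℕ, ∑ j ∈ Finset.range L, (1 / 4 : ℝ) ^ (j + 1) = (1 - (1 / 4) ^ L) / 3 := by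
    intro L
    induction L with
    | zero => simp
    | succ L ih => rw [Finset.sum_range_succ, ih]; ring
  rw [this]
  have : (0 : ℝ) < (1 / 4) ^ L := by positivity
  linarith

/-- There are linearly sparse uniform hypergraphs without a proper two-coloring. -/
theorem exists_isSparse_not_colorable {r : ℕ} (hr : 3 ≤ r) :
    ∃ M : ℕ, 0 < M ∧ ∀ N, 2 * r ≤ N → ∃ E : Finset (Finset (Fin (2 * N))),
      (∀ e ∈ E, e.card = r) ∧ (∀ g : Fin (2 * N) → Fin 2, ∃ e ∈ E, ∃ c, ∀ v ∈ e, g v = c) ∧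
      IsSparse r (2 * N / M) E := by
  classical
  set q := 7 * (r + 2) with hq
  obtain ⟨C, hC⟩ : ∃ C, C = 2 * 4 ^ r := ⟨_, rfl⟩
  obtain ⟨M, hM⟩ : ∃ M, M = (12 * C * 6 ^ r * r) ^ q * r := ⟨_, rfl⟩
  have hC0 : 0 < C := by rw [hC]; positivity
  have hrM : r ≤ M := by
    rw [hM]
    exact Nat.le_mul_of_pos_left _ (by positivity)
  refine ⟨M, by omega, fun N hN => ?_⟩
  obtain ⟨n, hn⟩ : ∃ n, n = 2 * N := ⟨_, rfl⟩
  obtain ⟨m, hm⟩ : ∃ m, m = C * n := ⟨_, rfl⟩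
  rw [← hn]
  obtain ⟨L, hL⟩ : ∃ L, L = n / M := ⟨_, rfl⟩
  have hLn : L * M ≤ n := hL ▸ Nat.div_mul_le_self n M
  rw [← hL]
  have hX : 0 < n.choose r := Nat.choose_pos (by omega)
  have hdense : ∀ j, 0 < j → j ≤ L → ((denseSeqs m n r j (sparseBound r j)).card : ℝ) ≤
      (n.choose r : ℝ) ^ m * (1 / 4) ^ j := by
    intro j hj hjL
    obtain ⟨ht, a, hta, -, ha2⟩ := sparseBound_spec hr hj
    set t := sparseBound r j
    have h1 := union_bound_term hC0 hj (by omega) ht (by omega : 2 * r ≤ n) hm hta ha2 hM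
      ((Nat.mul_le_mul_right M hjL).trans hLn)
    have h2 := card_denseSeqs_le m n r j t
    have h3 : (denseSeqs m n r j t).card * 4 ^ j ≤ n.choose r ^ m := by
      refine Nat.le_of_mul_le_mul_right (c := n.choose r ^ j) ?_ (by positivity)
      calc (denseSeqs m n r j t).card * 4 ^ j * n.choose r ^ j
          = (denseSeqs m n r j t).card * n.choose r ^ j * 4 ^ j := by ring
        _ ≤ m.choose j * n.choose t * t.choose r ^ j * n.choose r ^ m * 4 ^ j := by gcongr
        _ = n.choose r ^ m * (m.choose j * n.choose t * t.choose r ^ j * 4 ^ j) := by ring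
        _ ≤ n.choose r ^ m * n.choose r ^ j := by gcongr
    rw [one_div, inv_pow, ← div_eq_mul_inv, le_div_iff₀ (by positivity)]
    exact_mod_cast h3
  have hcol := card_colorableSeqs_le hN (by omega) hn (hm.trans (by rw [hC]))
  let bad := colorableSeqs m n r ∪
    (Finset.range L).biUnion fun j => denseSeqs m n r (j + 1) (sparseBound r (j + 1))
  -- Colorable sequences make up at most half of all. The dense ones make up at most the sum of `4 ^
  -- (-j)` over `1 ≤ j ≤ L`, which is below `1 / 3`.
  have hbad : bad.card < (edgeSeqs m n r).card := by
    have hX' : (0 : ℝ) < (n.choose r : ℝ) ^ m := by positivity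
    have h1 : (((Finset.range L).biUnion fun j =>
        denseSeqs m n r (j + 1) (sparseBound r (j + 1))).card : ℝ) ≤
        (n.choose r : ℝ) ^ m * ∑ j ∈ Finset.range L, (1 / 4) ^ (j + 1) := by
      rw [Finset.mul_sum]
      refine (Nat.cast_le.2 Finset.card_biUnion_le).trans ?_
      rw [Nat.cast_sum]
      exact Finset.sum_le_sum fun j hj => hdense (j + 1) j.succ_pos (Finset.mem_range.1 hj)
    have h2 : (bad.card : ℝ) ≤ _ := Nat.cast_le.2 (Finset.card_union_le _ _)
    rw [Nat.cast_add] at h2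
    rw [card_edgeSeqs, ← Nat.cast_lt (α := ℝ), Nat.cast_pow]
    nlinarith [sum_quarter_pow_lt L]
  obtain ⟨ω, hω, hnot⟩ := Finset.exists_mem_notMem_of_card_lt_card hbad
  simp only [bad, Finset.mem_union, Finset.mem_biUnion, Finset.mem_range, not_or, not_exists,
    not_and] at hnot
  have hgood : ∀ j, 0 < j → j ≤ L → ω ∉ denseSeqs m n r j (sparseBound r j) := by
    intro j hj hjL
    obtain ⟨i, rfl⟩ : ∃ i, j = i + 1 := ⟨j - 1, by omega⟩
    exact hnot.2 i (by omega)
  refine ⟨Finset.univ.image ω, ?_, ?_,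
    isSparse_of_notMem_denseSeqs hr (by nlinarith) hω hgood⟩
  · intro e he
    obtain ⟨i, -, rfl⟩ := Finset.mem_image.1 he
    exact (Finset.mem_powersetCard.1 (Fintype.mem_piFinset.1 hω i)).2
  · intro g
    by_contra hcon
    push Not at hcon
    refine hnot.1 (Finset.mem_filter.2 ⟨hω, g, fun i => ?_⟩)
    push Not
    exact hcon (ω i) (Finset.mem_image_of_mem _ (Finset.mem_univ _))

/-! ### The linear lower bound on width -/

theorem not_hasSublinearWidth {s r : ℕ} (hs : 0 < s) (hsr : s < r) (hr : 2 < r) :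
    ¬ PCSP.HasSublinearWidth (PCSP.exactlySAT s r) (PCSP.naeSAT r) := by
  rintro ⟨k, hk, hw⟩
  obtain ⟨M, hM, hE⟩ := exists_isSparse_not_colorable hr
  have hc : (0 : ℝ) < 1 / (4 * M * (7 * (r + 2))) := by positivity
  obtain ⟨n₀, hn₀⟩ := eventually_atTop.1 (hk.bound hc)
  -- With `n = 4 * a * M` vertices, sparsity holds up to `n / M = 4 * a = 2 * K` edges for `K = 2 *
  -- a`, and the choice of the little-o constant gives `7 * (r + 2) * k n ≤ a ≤ K`. The size of `a`
  -- ensures `n ≥ n₀` and enough vertices for the random construction.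
  obtain ⟨a, ha⟩ : ∃ a, a = n₀ + r + 1 := ⟨_, rfl⟩
  have haM : a ≤ a * M := Nat.le_mul_of_pos_right a hM
  obtain ⟨E, hEr, hcol, hsparse⟩ := hE (2 * (a * M)) (by omega)
  have hL : 2 * (2 * (a * M)) / M = 2 * (2 * a) := by
    rw [← mul_assoc, ← mul_assoc, Nat.mul_div_cancel _ hM]
    ring
  rw [hL] at hsparse
  refine not_homTo_naeSAT hEr hcol (hw _ _ ?_)
  rw [Fintype.card_fin]
  refine consistencyLE_edgeInstance hs hsr hr (by omega : 0 < 2 * a) ?_ hEr hsparse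
  have h := hn₀ (2 * (2 * (a * M))) (by omega)
  rw [Real.norm_of_nonneg (Nat.cast_nonneg _), Real.norm_of_nonneg (Nat.cast_nonneg _),
    div_mul_eq_mul_div, one_mul, le_div_iff₀ (by positivity)] at h
  have h' : k (2 * (2 * (a * M))) * (4 * M * (7 * (r + 2))) ≤ 2 * (2 * (a * M)) := by
    exact_mod_cast h
  have h2 : 4 * M * (7 * (r + 2) * k (2 * (2 * (a * M)))) ≤ 4 * M * a := by
    linarith
  have := Nat.le_of_mul_le_mul_left h2 (by positivity)
  omega

theorem corollary4p5 (s r : ℕ) (hs : 0 < s) (hsr : s < r) (hr : 2 < r) :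
    PCSP.IsTemplate (PCSP.exactlySAT s r) (PCSP.naeSAT r) ∧
    PCSP.HasSAWidth (PCSP.exactlySAT s r) (PCSP.naeSAT r) (fun _ => 2) ∧
    PCSP.HasBoundedSAWidth (PCSP.exactlySAT s r) (PCSP.naeSAT r) ∧
    ¬ PCSP.HasSublinearWidth (PCSP.exactlySAT s r) (PCSP.naeSAT r) ∧
    ¬ PCSP.HasBoundedWidth (PCSP.exactlySAT s r) (PCSP.naeSAT r) := by
  refine ⟨⟨id, fun _ t ht => ?_⟩, hasSAWidth_two s r hs hsr,
    ⟨fun _ => 2, isBigO_const_const _ one_ne_zero _, hasSAWidth_two s r hs hsr⟩,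
    not_hasSublinearWidth hs hsr hr,
    not_hasBoundedWidth_of_not_hasSublinearWidth (not_hasSublinearWidth hs hsr hr)⟩
  change (Finset.univ.filter fun i : Fin r => t i = 1).card = s at ht
  constructor
  · rintro (h : t = _)
    simp [h] at ht
    omega
  · rintro (h : t = _)
    simp [h] at ht
    omega
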